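/- Let $A,B,C,D\in\mathbb R$ with $AD-BC=1$ and let $S=\begin{pmatrix}A&B\\ C&D\end{pmatrix}$. For $x,\xi,\tau\in\mathbb R$ and $f\in L^2(\mathbb R)$ put $\rho(x,\xi;\tau)f(t)=e^{2\pi i\tau}e^{-i\pi x\xi}e^{2\pi i\xi t}f(t-x)$. Let $\hat S$ be a metaplectic operator with projection $S$, that is, a unitary operator on $L^2(\mathbb R)$ such that $\hat S\,\rho(x,\xi;\tau)\,\hat S^{-1}=\rho(Ax+B\xi,\,Cx+D\xi;\,\tau)$ for all $x,\xi,\tau\in\mathbb R$ (this determines $\hat S$ up to a phase factor). Let $k\in\mathcal S'(\mathbb R^2)$ be its Schwartz kernel, that is, $\langle k,g\otimes f\rangle=\int_{\mathbb R}\hat Sf(x)\,g(x)\,dx$ for all $f,g\in\mathcal S(\mathbb R)$, where $(g\otimes f)(x,y)=g(x)f(y)$. Let $\tilde k=k*\varphi$, where $\varphi(t)=e^{-\pi|t|^2}$ for $t\in\mathbb R^2$. The kernel $k$ is called quasi-diagonal if $\tilde k$ is continuous and for every integer $N>0$ there is a constant $C_N>0$ such that $$|\tilde k(x,y)|\le C_N\langle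 x-y\rangle^{-N}\qquad\text{for all }x,y\in\mathbb R,$$ where $\langle u\rangle=(1+|u|^2)^{1/2}$. Then $k$ is quasi-diagonal if and only if $D=1$ or $C\neq0$. -/

import Mathlib

open MeasureTheory
open scoped SchwartzMap ContDiff

noncomputable section

namespace Metaplectic

/-! ### The Hilbert space, the Schrödinger representation and metaplectic operators (`d = 1`) -/

/-- The Hilbert space `L²(ℝ)` of (classes of) complex-valued functions. -/
abbrev L2 : Type := Lp ℂ 2 (volume : Measure ℝ)

/-- The function `t ↦ e^{2πiτ} e^{-iπxξ} e^{2πiξt} f(t - x)`. -/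
def schrodingerFun (x ξ τ : ℝ) (f : ℝ → ℂ) (t : ℝ) : ℂ :=
  Complex.exp (((2 * Real.pi * τ : ℝ) : ℂ) * Complex.I) *
    Complex.exp (((-(Real.pi * x * ξ) : ℝ) : ℂ) * Complex.I) *
    Complex.exp (((2 * Real.pi * ξ * t : ℝ) : ℂ) * Complex.I) * f (t - x)

theorem memLp_schrodingerFun (x ξ τ : ℝ) (f : L2) :
    MemLp (schrodingerFun x ξ τ (f : ℝ → ℂ)) 2 (volume : Measure ℝ) := by
  have h1 : MemLp (fun t : ℝ => (f : ℝ → ℂ) (t - x)) 2 (volume : Measure ℝ) :=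
    (Lp.memLp f).comp_measurePreserving (measurePreserving_sub_right volume x)
  refine MemLp.of_le h1 ?_ ?_
  · unfold schrodingerFun
    exact (Continuous.aestronglyMeasurable (by fun_prop)).mul h1.1
  · filter_upwards with t
    simp only [schrodingerFun, norm_mul, Complex.norm_exp_ofReal_mul_I, one_mul, le_refl]

/-- The Schrödinger representation of the Heisenberg group on `L²(ℝ)`:
`ρ(x, ξ; τ) f (t) = e^{2πiτ} e^{-iπxξ} e^{2πiξt} f(t - x)`. -/
def rho (x ξ τ : ℝ) (f : L2) : L2 :=
  (memLp_schrodingerFun x ξ τ f).toLp (schrodingerFun x ξ τ (f : ℝ → ℂ))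

/-- `T` is a metaplectic operator with projection `S = (A B; C D)`: it is unitary on `L²(ℝ)` and
`T ρ(x, ξ; τ) T⁻¹ = ρ(S(x, ξ); τ)` for all `x, ξ, τ`. -/
def IsMetaplectic (A B C D : ℝ) (T : L2 ≃ₗᵢ[ℂ] L2) : Prop :=
  ∀ (x ξ τ : ℝ) (f : L2),
    T (rho x ξ τ (T.symm f)) = rho (A * x + B * ξ) (C * x + D * ξ) τ f

/-! ### Tensor products of Schwartz functions and Schwartz kernels -/

theorem decay_comp_clm (L : ℝ × ℝ →L[ℝ] ℝ) (hL : ‖L‖ ≤ 1) (g : 𝓢(ℝ, ℂ)) (k n : ℕ) :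
    ∃ M : ℝ, 0 ≤ M ∧ ∀ p : ℝ × ℝ, ‖L p‖ ^ k * ‖iteratedFDeriv ℝ n (fun q => g (L q)) p‖ ≤ M := by
  obtain ⟨M, hM⟩ := g.decay' k n
  have hM0 : 0 ≤ M := le_trans (by positivity) (hM 0)
  refine ⟨M, hM0, fun p => ?_⟩
  have h1 : ‖iteratedFDeriv ℝ n (fun q => g (L q)) p‖ ≤ ‖iteratedFDeriv ℝ n g (L p)‖ := by
    have h2 : iteratedFDeriv ℝ n (fun q => g (L q)) p =
        (iteratedFDeriv ℝ n g (L p)).compContinuousLinearMap fun _ => L :=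
      L.iteratedFDeriv_comp_right (f := g) g.smooth' p (mod_cast le_top)
    rw [h2]
    refine ((iteratedFDeriv ℝ n g (L p)).norm_compContinuousLinearMap_le _).trans ?_
    refine mul_le_of_le_one_right (norm_nonneg _) ?_
    exact Finset.prod_le_one (fun _ _ => norm_nonneg _) (fun _ _ => hL)
  exact (mul_le_mul_of_nonneg_left h1 (by positivity)).trans (hM (L p))

theorem tensor_smooth (g f : 𝓢(ℝ, ℂ)) : ContDiff ℝ ∞ (fun p : ℝ × ℝ => g p.1 * f p.2) :=
  (g.smooth'.comp contDiff_fst).mul (f.smooth'.comp contDiff_snd)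

theorem tensor_decay (g f : 𝓢(ℝ, ℂ)) (k n : ℕ) :
    ∃ M : ℝ, ∀ p : ℝ × ℝ,
      ‖p‖ ^ k * ‖iteratedFDeriv ℝ n (fun p : ℝ × ℝ => g p.1 * f p.2) p‖ ≤ M := by
  have hfst : ‖ContinuousLinearMap.fst ℝ ℝ ℝ‖ ≤ 1 := ContinuousLinearMap.norm_fst_le ..
  have hsnd : ‖ContinuousLinearMap.snd ℝ ℝ ℝ‖ ≤ 1 := ContinuousLinearMap.norm_snd_le ..
  choose G hG0 hG using decay_comp_clm (ContinuousLinearMap.fst ℝ ℝ ℝ) hfst g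
  choose F hF0 hF using decay_comp_clm (ContinuousLinearMap.snd ℝ ℝ ℝ) hsnd f
  refine ⟨∑ i ∈ Finset.range (n + 1), (n.choose i : ℝ) *
    (G k i * F 0 (n - i) + G 0 i * F k (n - i)), fun p => ?_⟩
  have h := norm_iteratedFDeriv_mul_le (𝕜 := ℝ) (n := n) (N := ∞)
    (g.smooth'.comp contDiff_fst : ContDiff ℝ ∞ (fun p : ℝ × ℝ => g p.1))
    (f.smooth'.comp contDiff_snd : ContDiff ℝ ∞ (fun p : ℝ × ℝ => f p.2)) p
    (mod_cast le_top)
  refine (mul_le_mul_of_nonneg_left h (by positivity)).trans ?_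
  rw [Finset.mul_sum]
  refine Finset.sum_le_sum fun i _ => ?_
  set a := ‖iteratedFDeriv ℝ i (fun p : ℝ × ℝ => g p.1) p‖ with ha
  set b := ‖iteratedFDeriv ℝ (n - i) (fun p : ℝ × ℝ => f p.2) p‖ with hb
  have ha0 : 0 ≤ a := norm_nonneg _
  have hb0 : 0 ≤ b := norm_nonneg _
  have g1 : ‖p.1‖ ^ k * a ≤ G k i := hG k i p
  have g0 : a ≤ G 0 i := by simpa using hG 0 i p
  have f1 : ‖p.2‖ ^ k * b ≤ F k (n - i) := hF k (n - i) p
  have f0 : b ≤ F 0 (n - i) := by simpa using hF 0 (n - i) p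
  have hp : ‖p‖ ^ k ≤ ‖p.1‖ ^ k + ‖p.2‖ ^ k := by
    rw [Prod.norm_def]
    rcases max_cases ‖p.1‖ ‖p.2‖ with h | h <;> rw [h.1]
    · exact le_add_of_nonneg_right (by positivity)
    · exact le_add_of_nonneg_left (by positivity)
  have e1 : (‖p.1‖ ^ k * a) * b ≤ G k i * F 0 (n - i) := mul_le_mul g1 f0 hb0 (hG0 k i)
  have e2 : a * (‖p.2‖ ^ k * b) ≤ G 0 i * F k (n - i) :=
    mul_le_mul g0 f1 (by positivity) (hG0 0 i)
  have e3 : ‖p‖ ^ k * (a * b) ≤ (‖p.1‖ ^ k + ‖p.2‖ ^ k) * (a * b) :=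
    mul_le_mul_of_nonneg_right hp (by positivity)
  calc ‖p‖ ^ k * ((n.choose i : ℝ) * a * b) = (n.choose i : ℝ) * (‖p‖ ^ k * (a * b)) := by ring
    _ ≤ _ := mul_le_mul_of_nonneg_left (by linarith) (by positivity)

/-- The tensor product `(g ⊗ f)(x, y) = g(x) f(y)` of two Schwartz functions on `ℝ`, a Schwartz
function on `ℝ²`. (On `ℝ × ℝ` Mathlib's norm is the maximum norm; it gives the same Schwartz space
as the Euclidean norm.) -/
def tensor (g f : 𝓢(ℝ, ℂ)) : 𝓢(ℝ × ℝ, ℂ) where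
  toFun p := g p.1 * f p.2
  smooth' := tensor_smooth g f
  decay' := tensor_decay g f

/-- The tempered distribution `k` on `ℝ²` is the Schwartz kernel of `T`, that is
`T f (x) = ∫ k(x, y) f(y) dy` in the sense of distributions:
`⟨T f, g⟩ = ⟨k, g ⊗ f⟩` for all Schwartz functions `f, g` on `ℝ` (bilinear pairings). -/
def IsKernel (T : L2 ≃ₗᵢ[ℂ] L2) (k : 𝓢'(ℝ × ℝ, ℂ)) : Prop :=
  ∀ f g : 𝓢(ℝ, ℂ),
    ∫ x : ℝ, (T (f.toLp 2) : ℝ → ℂ) x * g x = k (tensor g f)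

/-! ### The Gaussian, smoothing, and quasi-diagonality -/

theorem gaussian_smooth : ContDiff ℝ ∞ (fun x : ℝ => Complex.exp (-(Real.pi * x ^ 2 : ℝ))) := by
  have h0 : ContDiff ℝ ∞ (fun x : ℝ => Real.pi * x ^ 2) := by fun_prop
  have h : ContDiff ℝ ∞ (fun x : ℝ => ((Real.pi * x ^ 2 : ℝ) : ℂ)) :=
    Complex.ofRealCLM.contDiff.comp h0
  exact h.neg.cexp

theorem iteratedDeriv_gaussian (n : ℕ) : ∃ P : Polynomial ℂ, ∀ x : ℝ,
    iteratedDeriv n (fun x : ℝ => Complex.exp (-(Real.pi * x ^ 2 : ℝ))) x =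
      P.eval (x : ℂ) * Complex.exp (-(Real.pi * x ^ 2 : ℝ)) := by
  induction n with
  | zero => exact ⟨1, fun x => by simp⟩
  | succ n ih =>
    obtain ⟨P, hP⟩ := ih
    refine ⟨Polynomial.derivative P - Polynomial.C (2 * Real.pi : ℂ) * Polynomial.X * P,
      fun x => ?_⟩
    rw [iteratedDeriv_succ, funext hP]
    have h1 : HasDerivAt (fun x : ℝ => P.eval (x : ℂ)) ((Polynomial.derivative P).eval (x : ℂ)) x :=
      (P.hasDerivAt (x : ℂ)).comp_ofReal
    have h2 : HasDerivAt (fun x : ℝ => -((Real.pi * x ^ 2 : ℝ) : ℂ))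
        (-((Real.pi * (2 * x) : ℝ) : ℂ)) x := by
      have h3 : HasDerivAt (fun x : ℝ => Real.pi * x ^ 2) (Real.pi * (2 * x)) x := by
        simpa using (hasDerivAt_pow 2 x).const_mul Real.pi
      exact h3.ofReal_comp.neg
    refine (h1.mul h2.cexp).deriv.trans ?_
    simp only [Polynomial.eval_sub, Polynomial.eval_mul, Polynomial.eval_C, Polynomial.eval_X]
    push_cast
    ring

theorem gaussian_pow_bound (m : ℕ) :
    ∃ M : ℝ, ∀ x : ℝ, |x| ^ m * Real.exp (-(Real.pi * x ^ 2)) ≤ M := by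
  refine ⟨1 + (m.factorial : ℝ), fun x => ?_⟩
  have hx : |x| ^ m ≤ 1 + (x ^ 2) ^ m := by
    rcases le_total |x| 1 with h | h
    · exact (pow_le_one₀ (abs_nonneg x) h).trans (le_add_of_nonneg_right (by positivity))
    · have : |x| ^ m ≤ |x| ^ (2 * m) := pow_le_pow_right₀ h (by omega)
      rw [pow_mul, sq_abs] at this
      linarith
  have h1 : (x ^ 2) ^ m ≤ m.factorial * Real.exp (x ^ 2) := by
    have := Real.pow_div_factorial_le_exp (x ^ 2) (sq_nonneg x) m
    rwa [div_le_iff₀ (by positivity), mul_comm] at this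
  have h2 : Real.exp (-(Real.pi * x ^ 2)) ≤ Real.exp (-(x ^ 2)) := by
    apply Real.exp_le_exp.2
    nlinarith [Real.pi_gt_three, sq_nonneg x]
  have h3 : Real.exp (-(x ^ 2)) ≤ 1 := Real.exp_le_one_iff.2 (by nlinarith [sq_nonneg x])
  calc |x| ^ m * Real.exp (-(Real.pi * x ^ 2))
      ≤ (1 + m.factorial * Real.exp (x ^ 2)) * Real.exp (-(x ^ 2)) :=
        mul_le_mul (by linarith) h2 (by positivity) (by positivity)
    _ = Real.exp (-(x ^ 2)) + m.factorial * (Real.exp (x ^ 2) * Real.exp (-(x ^ 2))) := by ring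
    _ = Real.exp (-(x ^ 2)) + m.factorial := by rw [← Real.exp_add]; simp
    _ ≤ 1 + m.factorial := by linarith

theorem gaussian_decay (k n : ℕ) : ∃ M : ℝ, ∀ x : ℝ,
    ‖x‖ ^ k * ‖iteratedFDeriv ℝ n (fun x : ℝ => Complex.exp (-(Real.pi * x ^ 2 : ℝ))) x‖ ≤ M := by
  obtain ⟨P, hP⟩ := iteratedDeriv_gaussian n
  choose G hG using gaussian_pow_bound
  refine ⟨∑ i ∈ Finset.range (P.natDegree + 1), ‖P.coeff i‖ * G (k + i), fun x => ?_⟩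
  have he : ‖Complex.exp (-(Real.pi * x ^ 2 : ℝ))‖ = Real.exp (-(Real.pi * x ^ 2)) := by
    rw [← Complex.ofReal_neg, Complex.norm_exp_ofReal]
  rw [norm_iteratedFDeriv_eq_norm_iteratedDeriv, hP x, norm_mul, he, Polynomial.eval_eq_sum_range]
  have h1 : ‖∑ i ∈ Finset.range (P.natDegree + 1), P.coeff i * (x : ℂ) ^ i‖ ≤
      ∑ i ∈ Finset.range (P.natDegree + 1), ‖P.coeff i‖ * |x| ^ i := by
    refine (norm_sum_le _ _).trans (le_of_eq ?_)
    simp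
  calc ‖x‖ ^ k * (‖∑ i ∈ Finset.range (P.natDegree + 1), P.coeff i * (x : ℂ) ^ i‖ *
        Real.exp (-(Real.pi * x ^ 2)))
      ≤ ‖x‖ ^ k * ((∑ i ∈ Finset.range (P.natDegree + 1), ‖P.coeff i‖ * |x| ^ i) *
        Real.exp (-(Real.pi * x ^ 2))) := by gcongr
    _ = ∑ i ∈ Finset.range (P.natDegree + 1),
        ‖P.coeff i‖ * (|x| ^ (k + i) * Real.exp (-(Real.pi * x ^ 2))) := by
      rw [Finset.sum_mul, Finset.mul_sum]
      refine Finset.sum_congr rfl fun i _ => ?_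
      rw [Real.norm_eq_abs, pow_add]
      ring
    _ ≤ _ := Finset.sum_le_sum fun i _ =>
      mul_le_mul_of_nonneg_left (hG (k + i) x) (norm_nonneg _)

/-- The Gaussian `x ↦ e^{-πx²}` as a Schwartz function on `ℝ`. -/
def gaussian₁ : 𝓢(ℝ, ℂ) where
  toFun x := Complex.exp (-(Real.pi * x ^ 2 : ℝ))
  smooth' := gaussian_smooth
  decay' := gaussian_decay

theorem tensor_gaussian₁ : (fun p : ℝ × ℝ => tensor gaussian₁ gaussian₁ p) =
    fun p : ℝ × ℝ => Complex.exp (-(Real.pi * (p.1 ^ 2 + p.2 ^ 2) : ℝ)) := by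
  funext p
  change Complex.exp (-(Real.pi * p.1 ^ 2 : ℝ)) * Complex.exp (-(Real.pi * p.2 ^ 2 : ℝ)) = _
  rw [← Complex.exp_add]
  congr 1
  push_cast
  ring

/-- The Gaussian `φ(t) = e^{-π|t|²}`, `t ∈ ℝ²`, as a Schwartz function on `ℝ²`
(`|t|` is the Euclidean norm). -/
def gaussian : 𝓢(ℝ × ℝ, ℂ) where
  toFun p := Complex.exp (-(Real.pi * (p.1 ^ 2 + p.2 ^ 2) : ℝ))
  smooth' := tensor_gaussian₁ ▸ (tensor gaussian₁ gaussian₁).smooth'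
  decay' := tensor_gaussian₁ ▸ (tensor gaussian₁ gaussian₁).decay'

/-- The Schwartz function `t ↦ ψ(a - t)`. -/
def reflectTranslate (ψ : 𝓢(ℝ × ℝ, ℂ)) (a : ℝ × ℝ) : 𝓢(ℝ × ℝ, ℂ) :=
  SchwartzMap.compSubConstCLM ℂ a
    (SchwartzMap.compCLMOfContinuousLinearEquiv ℂ (ContinuousLinearEquiv.neg ℝ) ψ)

theorem reflectTranslate_apply (ψ : 𝓢(ℝ × ℝ, ℂ)) (a t : ℝ × ℝ) :
    reflectTranslate ψ a t = ψ (a - t) := by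
  simp [reflectTranslate]

/-- The convolution `k ∗ ψ` of a tempered distribution with a Schwartz function:
the function `a ↦ ⟨k, ψ(a - ·)⟩`. -/
def convolution (k : 𝓢'(ℝ × ℝ, ℂ)) (ψ : 𝓢(ℝ × ℝ, ℂ)) (a : ℝ × ℝ) : ℂ :=
  k (reflectTranslate ψ a)

/-- The smoothed kernel `k ∗ φ`, where `φ(t) = e^{-π|t|²}`. -/
def smoothedKernel (k : 𝓢'(ℝ × ℝ, ℂ)) : ℝ × ℝ → ℂ :=
  convolution k gaussian

/-- `⟨x⟩ = (1 + |x|²)^{1/2}`. -/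
def japaneseBracket (x : ℝ) : ℝ := Real.sqrt (1 + |x| ^ 2)

/-- A continuous function `k` on `ℝ²` is a diagonal kernel if for every integer `N > 0` there is
`C_N > 0` with `|k(x, y)| ≤ C_N ⟨x - y⟩^{-N}` for all `x, y`. -/
def IsDiagonalKernel (k : ℝ × ℝ → ℂ) : Prop :=
  Continuous k ∧ ∀ N : ℕ, 0 < N → ∃ C : ℝ, 0 < C ∧ ∀ x y : ℝ,
    ‖k (x, y)‖ ≤ C * japaneseBracket (x - y) ^ (-(N : ℤ))

/-- A tempered distribution on `ℝ²` is quasi-diagonal if its smoothed kernel is a diagonal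
kernel. -/
def IsQuasiDiagonal (k : 𝓢'(ℝ × ℝ, ℂ)) : Prop :=
  IsDiagonalKernel (smoothedKernel k)

end Metaplectic

end

open scoped ComplexConjugate

namespace Metaplectic

/-! Only the modulus of the smoothed kernel matters for decay, and it can be computed exactly
without an explicit formula for `T`. The value at `(x, y)` is the inner product of a Gaussian
centred at `x` with `T` of one centred at `y`. By `integral_integral_gaussian_mul_ambiguity`, the
squared pairing of any `h` with the Gaussian is a Gaussian average of its ambiguity function.
Ambiguity functions see `T` only through the substitution `S⁻¹` (`IsMetaplectic.inner_rho`), so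
everything reduces to a planar Gaussian integral.

The result, `norm_smoothedKernel_sq`, is `|k̃(x, y)|² = c exp(-π Q(-Cy, Ay - x))` with `c > 0` and
`Q` positive definite. If `C ≠ 0`, or `C = 0` and `A = D = 1`, then `|x - y|` is controlled by
`|Cy|` and `|Ay - x|`, which gives Gaussian decay off the diagonal. If `C = 0` and `D ≠ 1`, then `A
≠ 1` and `|k̃|` is the constant `√c` along the line `x = Ay`, which moves away from the diagonal. -/

/-! ### Gaussian integrals and averaged ambiguity functions. -/

theorem integral_cexp_neg_quadratic {a : ℝ} (ha : 0 < a) (c d : ℂ) :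
    ∫ x : ℝ, Complex.exp (-(a : ℂ) * x ^ 2 + c * x + d) =
      (Real.sqrt (Real.pi / a) : ℂ) * Complex.exp (d + c ^ 2 / (4 * a)) := by
  rw [integral_cexp_quadratic (by simpa using ha)]
  congr 1
  · rw [neg_neg, ← Complex.ofReal_div, Real.sqrt_eq_rpow,
      Complex.ofReal_cpow (by positivity)]
    norm_num
  · congr 1
    have : (a : ℂ) ≠ 0 := by exact_mod_cast ha.ne'
    field_simp
    ring

theorem gaussian₁_apply (t : ℝ) : gaussian₁ t = Complex.exp (-(Real.pi * t ^ 2 : ℝ)) := rfl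

theorem rho_coeFn (x ξ τ : ℝ) (f : L2) :
    (rho x ξ τ f : ℝ → ℂ) =ᵐ[volume] schrodingerFun x ξ τ f :=
  MemLp.coeFn_toLp _

theorem schrodingerFun_congr (x ξ τ : ℝ) {f g : ℝ → ℂ} (h : f =ᵐ[volume] g) :
    schrodingerFun x ξ τ f =ᵐ[volume] schrodingerFun x ξ τ g := by
  have h' := (measurePreserving_sub_right (volume : Measure ℝ) x).quasiMeasurePreserving.ae_eq h
  filter_upwards [h'] with t ht
  simp only [schrodingerFun]
  congr 1

theorem inner_rho (h f : L2) (x ξ τ : ℝ) :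
    inner ℂ h (rho x ξ τ f) = ∫ t, schrodingerFun x ξ τ f t * conj (h t) := by
  rw [L2.inner_def]
  refine integral_congr_ae ?_
  filter_upwards [rho_coeFn x ξ τ f] with t ht
  rw [RCLike.inner_apply, ht]

/-- The Gaussian average in frequency of the ambiguity function of `h`. -/
theorem integral_gaussian_mul_ambiguity (h : L2) (x : ℝ) :
    ∫ ξ : ℝ, Complex.exp (-(Real.pi * (x ^ 2 + ξ ^ 2) / 2 : ℝ)) * inner ℂ h (rho x ξ 0 h) =
      (Real.sqrt 2 : ℂ) *
        ∫ t : ℝ, (conj (h t) * gaussian₁ t) * (h (t - x) * gaussian₁ (t - x)) := by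
  have hx : MemLp (fun t : ℝ => h (t - x)) 2 (volume : Measure ℝ) :=
    (Lp.memLp h).comp_measurePreserving (measurePreserving_sub_right volume x)
  have hF : Integrable (fun t : ℝ => h (t - x) * conj (h t)) :=
    hx.integrable_mul (Lp.memLp h).star
  have hG : Integrable (fun ξ : ℝ => Complex.exp (-(Real.pi / 2 : ℝ) * ξ ^ 2 )) :=
    integrable_cexp_neg_mul_sq (b := ((Real.pi / 2 : ℝ) : ℂ))
      (by rw [Complex.ofReal_re]; positivity)
  -- Fubini applies: the integrand is a Gaussian in `ξ` times an `L¹` function of `t`, up to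
  -- unimodular phases.
  have hp := (hG.mul_prod hF).bdd_mul (c := 1)
    (f := fun p : ℝ × ℝ => Complex.exp ((-(Real.pi * x * p.1) : ℝ) * Complex.I) *
      Complex.exp ((2 * Real.pi * p.1 * p.2 : ℝ) * Complex.I))
    (Continuous.aestronglyMeasurable (by fun_prop)) (Filter.Eventually.of_forall fun p => by
      simp only [norm_mul, Complex.norm_exp_ofReal_mul_I, one_mul, le_refl])
  have hp' := hp.const_mul (Complex.exp (-(Real.pi * x ^ 2 / 2 : ℝ)))
  simp only [inner_rho, ← integral_const_mul]
  rw [integral_integral_swap (by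
    refine hp'.congr (Filter.Eventually.of_forall fun p => ?_)
    simp only [Function.uncurry, schrodingerFun]
    have : Complex.exp (-(Real.pi * (x ^ 2 + p.1 ^ 2) / 2 : ℝ)) =
      Complex.exp (-(Real.pi * x ^ 2 / 2 : ℝ)) * Complex.exp (-(Real.pi / 2 : ℝ) * p.1 ^ 2) := by
      rw [← Complex.exp_add]; congr 1; push_cast; ring
    rw [this]
    simp
    ring)]
  refine integral_congr_ae (Filter.Eventually.of_forall fun t => ?_)
  -- The `ξ`-integral gives a Gaussian in `t - x/2`, and `2(t - x/2)² + x²/2 = t² + (t - x)²` splits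
  -- it into two factors.
  have key := integral_cexp_neg_quadratic (a := Real.pi / 2) (by positivity)
    (2 * Real.pi * (t - x / 2) * Complex.I) (-(Real.pi * x ^ 2 / 2 : ℝ))
  have h2 : Real.pi / (Real.pi / 2) = 2 := by field_simp
  rw [h2] at key
  dsimp only
  calc _ = ∫ ξ : ℝ, Complex.exp (-((Real.pi / 2 : ℝ) : ℂ) * ξ ^ 2 +
        (2 * Real.pi * (t - x / 2) * Complex.I) * ξ + (-(Real.pi * x ^ 2 / 2 : ℝ))) *
        (h (t - x) * conj (h t)) := by
        congr 1; funext ξ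
        simp only [schrodingerFun]
        have : ∀ z w : ℂ, ∀ a b c d : ℂ, a * (b * c * d * z * w) = (a * b * c * d) * (z * w) := by
          intros; ring
        rw [this, ← Complex.exp_add, ← Complex.exp_add, ← Complex.exp_add]
        congr 2
        push_cast; ring
    _ = _ := by
        rw [integral_mul_const, key, gaussian₁_apply, gaussian₁_apply]
        have : ∀ z w : ℂ, ∀ a b c : ℂ,
          a * ((w * b) * (z * c)) = a * (b * c) * (z * w) := by intros; ring
        rw [this, ← Complex.exp_add]
        congr 3
        push_cast
        have : (Real.pi : ℂ) ≠ 0 := by exact_mod_cast Real.pi_ne_zero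
        field_simp
        rw [Complex.I_sq]
        ring

/-- The Gaussian average of the ambiguity function of `h` is the squared modulus of the pairing of
`h` with the Gaussian. -/
theorem integral_integral_gaussian_mul_ambiguity (h : L2) :
    ∫ x : ℝ, ∫ ξ : ℝ, Complex.exp (-(Real.pi * (x ^ 2 + ξ ^ 2) / 2 : ℝ)) *
        inner ℂ h (rho x ξ 0 h) =
      ((Real.sqrt 2 * ‖∫ t : ℝ, h t * gaussian₁ t‖ ^ 2 : ℝ) : ℂ) := by
  simp only [integral_gaussian_mul_ambiguity, integral_const_mul]
  have hG : MemLp gaussian₁ 2 (volume : Measure ℝ) := gaussian₁.memLp 2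
  have h1 : Integrable (fun t : ℝ => conj (h t) * gaussian₁ t) :=
    (Lp.memLp h).star.integrable_mul hG
  have h2 : Integrable (fun t : ℝ => h t * gaussian₁ t) := (Lp.memLp h).integrable_mul hG
  -- What remains is the integral of a convolution, hence a product of two integrals, conjugate to
  -- each other because the Gaussian is real.
  have h3 := integral_convolution (ContinuousLinearMap.mul ℂ ℂ) h1 h2.comp_neg
  simp only [MeasureTheory.convolution, ContinuousLinearMap.mul_apply', neg_sub] at h3
  rw [h3, integral_neg_eq_self (fun t : ℝ => h t * gaussian₁ t)]
  have h4 : ∫ t : ℝ, conj (h t) * gaussian₁ t = conj (∫ t : ℝ, h t * gaussian₁ t) := by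
    rw [← integral_conj]
    congr 1; funext t
    rw [map_mul, gaussian₁_apply, ← Complex.ofReal_neg, ← Complex.ofReal_exp, Complex.conj_ofReal]
  rw [h4, Complex.conj_mul']
  push_cast
  rfl

/-- Complete the square in `ξ`, then in `x`; `e` is the Schur complement of `d` in the matrix `(a b;
b d)`, and the final exponent is the inverse quadratic form at `(r, s)`. -/
theorem integral_integral_gaussian_quadratic {a b d e : ℝ} (hd : 0 < d) (he : 0 < e)
    (h : e * d = a * d - b ^ 2) (r s : ℝ) :
    ∫ x : ℝ, ∫ ξ : ℝ, Complex.exp (-(Real.pi * (a * x ^ 2 + 2 * b * x * ξ + d * ξ ^ 2) : ℝ) +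
        (2 * Real.pi * (r * x + s * ξ) : ℝ) * Complex.I) =
      ((Real.sqrt (1 / d) * Real.sqrt (1 / e) *
        Real.exp (-(Real.pi * (s ^ 2 / d + (r - s * b / d) ^ 2 / e))) : ℝ) : ℂ) := by
  have hd' : (d : ℂ) ≠ 0 := by exact_mod_cast hd.ne'
  have he' : (e : ℂ) ≠ 0 := by exact_mod_cast he.ne'
  have hpi : (Real.pi : ℂ) ≠ 0 := by exact_mod_cast Real.pi_ne_zero
  have hpd : Real.pi / (Real.pi * d) = 1 / d := by field_simp
  have hpe : Real.pi / (Real.pi * e) = 1 / e := by field_simp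
  have ha : (a : ℂ) = e + b ^ 2 / d := by
    have : a = e + b ^ 2 / d := by field_simp; linarith
    exact_mod_cast this
  have inner_eq : ∀ x : ℝ, ∫ ξ : ℝ,
      Complex.exp (-(Real.pi * (a * x ^ 2 + 2 * b * x * ξ + d * ξ ^ 2) : ℝ) +
        (2 * Real.pi * (r * x + s * ξ) : ℝ) * Complex.I) =
      (Real.sqrt (1 / d) : ℂ) * Complex.exp (-((Real.pi * e : ℝ) : ℂ) * x ^ 2 +
        (2 * Real.pi * (r - s * b / d) * Complex.I) * x + (-(Real.pi * s ^ 2 / d))) := by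
    intro x
    have key := integral_cexp_neg_quadratic (a := Real.pi * d) (by positivity)
      (-(2 * Real.pi * b * x) + 2 * Real.pi * s * Complex.I)
      (-(Real.pi * a * x ^ 2) + 2 * Real.pi * r * x * Complex.I)
    rw [hpd] at key
    calc _ = _ := by congr 1; funext ξ; congr 1; push_cast; ring
      _ = _ := key
      _ = _ := by
        congr 2
        rw [ha]
        push_cast
        field_simp
        ring_nf
        rw [Complex.I_sq]
        ring
  simp only [inner_eq, integral_const_mul]
  rw [integral_cexp_neg_quadratic (by positivity), hpe, ← mul_assoc]
  push_cast
  congr 2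
  field_simp
  ring_nf
  rw [Complex.I_sq]
  ring

/-! ### The smoothed kernel as an inner product; continuity. -/

/-- The translated Gaussian `t ↦ e^{-π(t-a)²}`. -/
noncomputable def gaussianTranslate (a : ℝ) : 𝓢(ℝ, ℂ) := SchwartzMap.compSubConstCLM ℂ a gaussian₁

theorem gaussianTranslate_apply (a t : ℝ) :
    gaussianTranslate a t = Complex.exp (-(Real.pi * (t - a) ^ 2 : ℝ)) := by
  rw [gaussianTranslate, SchwartzMap.compSubConstCLM_apply, gaussian₁_apply]

theorem tensor_gaussianTranslate (x y : ℝ) :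
    tensor (gaussianTranslate x) (gaussianTranslate y) = reflectTranslate gaussian (x, y) := by
  ext p
  rw [reflectTranslate_apply]
  change gaussianTranslate x p.1 * gaussianTranslate y p.2 =
    Complex.exp (-(Real.pi * ((x - p.1) ^ 2 + (y - p.2) ^ 2) : ℝ))
  rw [gaussianTranslate_apply, gaussianTranslate_apply, ← Complex.exp_add]
  congr 1
  push_cast
  ring

/-- The translated Gaussian as an element of `L²(ℝ)`. -/
noncomputable def gaussianL2 (a : ℝ) : L2 := (gaussianTranslate a).toLp 2

theorem gaussianL2_coeFn (a : ℝ) :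
    (gaussianL2 a : ℝ → ℂ) =ᵐ[volume] fun t => Complex.exp (-(Real.pi * (t - a) ^ 2 : ℝ)) := by
  filter_upwards [(gaussianTranslate a).coeFn_toLp 2 volume] with t ht
  rw [← gaussianTranslate_apply]
  exact ht

theorem smoothedKernel_apply {T : L2 ≃ₗᵢ[ℂ] L2} {k : 𝓢'(ℝ × ℝ, ℂ)} (hk : IsKernel T k)
    (x y : ℝ) : smoothedKernel k (x, y) =
      ∫ t : ℝ, (T (gaussianL2 y) : ℝ → ℂ) t * gaussianTranslate x t := by
  rw [smoothedKernel, convolution, ← tensor_gaussianTranslate]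
  exact (hk _ _).symm

theorem smoothedKernel_eq_inner {T : L2 ≃ₗᵢ[ℂ] L2} {k : 𝓢'(ℝ × ℝ, ℂ)} (hk : IsKernel T k)
    (x y : ℝ) : smoothedKernel k (x, y) = inner ℂ (gaussianL2 x) (T (gaussianL2 y)) := by
  rw [smoothedKernel_apply hk, L2.inner_def]
  refine integral_congr_ae ?_
  filter_upwards [gaussianL2_coeFn x] with t ht
  rw [RCLike.inner_apply, ht, gaussianTranslate_apply, ← Complex.ofReal_neg, ← Complex.ofReal_exp,
    Complex.conj_ofReal]

theorem inner_gaussianL2 (x y : ℝ) : inner ℂ (gaussianL2 x) (gaussianL2 y) =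
    (Real.sqrt (1 / 2) : ℂ) * Complex.exp (-(Real.pi * (x - y) ^ 2 / 2 : ℝ)) := by
  have key := integral_cexp_neg_quadratic (a := Real.pi * 2) (by positivity)
    (2 * Real.pi * (x + y)) (-(Real.pi * (x ^ 2 + y ^ 2)))
  have hpd : Real.pi / (Real.pi * 2) = 1 / 2 := by field_simp
  rw [hpd] at key
  rw [L2.inner_def]
  calc _ = _ := integral_congr_ae ?_
    _ = _ := key
    _ = _ := by
      congr 2
      have hpi : (Real.pi : ℂ) ≠ 0 := by exact_mod_cast Real.pi_ne_zero
      push_cast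
      field_simp
      ring
  filter_upwards [gaussianL2_coeFn x, gaussianL2_coeFn y] with t hx hy
  rw [RCLike.inner_apply, hx, hy, ← Complex.exp_conj, ← Complex.exp_add]
  congr 1
  rw [map_neg, Complex.conj_ofReal]
  push_cast
  ring

/-- Expanding the square expresses the distance through the explicit inner products. -/
theorem continuous_gaussianL2 : Continuous gaussianL2 := by
  rw [continuous_iff_continuousAt]
  intro y
  rw [ContinuousAt, tendsto_iff_norm_sub_tendsto_zero]
  have h : ∀ x, ‖gaussianL2 x - gaussianL2 y‖ =
      Real.sqrt (2 * Real.sqrt (1 / 2) * (1 - Real.exp (-(Real.pi * (x - y) ^ 2 / 2)))) := by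
    intro x
    have hre : ∀ u v, (inner ℂ (gaussianL2 u) (gaussianL2 v)).re =
        Real.sqrt (1 / 2) * Real.exp (-(Real.pi * (u - v) ^ 2 / 2)) := by
      intro u v
      rw [inner_gaussianL2, ← Complex.ofReal_neg, ← Complex.ofReal_exp, ← Complex.ofReal_mul,
        Complex.ofReal_re]
    have hself : ∀ u, ‖gaussianL2 u‖ ^ 2 = Real.sqrt (1 / 2) := by
      intro u
      rw [@norm_sq_eq_re_inner ℂ]
      refine (hre u u).trans ?_
      simp
    rw [← Real.sqrt_sq (norm_nonneg (gaussianL2 x - gaussianL2 y)), @norm_sub_sq ℂ, hself, hself]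
    refine congrArg Real.sqrt ?_
    have := hre x y
    simp only [RCLike.re_to_complex, this]
    ring
  simp only [h]
  refine Continuous.tendsto' (by fun_prop) _ _ (by simp)

theorem continuous_smoothedKernel {T : L2 ≃ₗᵢ[ℂ] L2} {k : 𝓢'(ℝ × ℝ, ℂ)} (hk : IsKernel T k) :
    Continuous (smoothedKernel k) := by
  have : smoothedKernel k = fun p => inner ℂ (gaussianL2 p.1) (T (gaussianL2 p.2)) :=
    funext fun p => smoothedKernel_eq_inner hk p.1 p.2
  rw [this]
  exact (continuous_gaussianL2.comp continuous_fst).inner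
    (T.continuous.comp (continuous_gaussianL2.comp continuous_snd))

/-! ### Closed formula for the modulus of the smoothed kernel. -/

/-- The ambiguity function of a time-frequency shifted Gaussian. -/
theorem ambiguity_rho_gaussianL2 (p q y v w : ℝ) :
    inner ℂ (rho p q 0 (gaussianL2 y)) (rho v w 0 (rho p q 0 (gaussianL2 y))) =
      (Real.sqrt (1 / 2) : ℂ) * Complex.exp (-(Real.pi * (v ^ 2 + w ^ 2) / 2 : ℝ) +
        (2 * Real.pi * (w * (p + y) - q * v) : ℝ) * Complex.I) := by
  have key := integral_cexp_neg_quadratic (a := Real.pi * 2) (by positivity)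
    (2 * Real.pi * (2 * (p + y) + v) + 2 * Real.pi * w * Complex.I)
    (-(Real.pi * ((p + y) ^ 2 + (p + y + v) ^ 2)) - Real.pi * (v * w + 2 * q * v) * Complex.I)
  have hpd : Real.pi / (Real.pi * 2) = 1 / 2 := by field_simp
  rw [hpd] at key
  rw [inner_rho]
  calc _ = _ := integral_congr_ae ?_
    _ = _ := key
    _ = _ := by
      congr 2
      have hpi : (Real.pi : ℂ) ≠ 0 := by exact_mod_cast Real.pi_ne_zero
      push_cast
      field_simp
      ring_nf
      rw [Complex.I_sq]
      ring
  have hu : (rho p q 0 (gaussianL2 y) : ℝ → ℂ) =ᵐ[volume] _ :=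
    (rho_coeFn p q 0 (gaussianL2 y)).trans (schrodingerFun_congr p q 0 (gaussianL2_coeFn y))
  filter_upwards [hu, schrodingerFun_congr v w 0 hu] with t h1 h2
  rw [h1, h2]
  simp only [schrodingerFun, map_mul, ← Complex.exp_conj, map_neg, Complex.conj_ofReal,
    Complex.conj_I]
  simp only [← Complex.exp_add]
  congr 1
  push_cast
  ring

/-- Intertwining at the point `S⁻¹(x, ξ)`, followed by unitarity of `T`. -/
theorem IsMetaplectic.inner_rho {A B C D : ℝ} (hS : A * D - B * C = 1) {T : L2 ≃ₗᵢ[ℂ] L2}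
    (hT : IsMetaplectic A B C D T) (f : L2) (x ξ : ℝ) :
    inner ℂ (T f) (rho x ξ 0 (T f)) =
      inner ℂ f (rho (D * x - B * ξ) (-C * x + A * ξ) 0 f) := by
  have h := hT (D * x - B * ξ) (-C * x + A * ξ) 0 (T f)
  rw [T.symm_apply_apply] at h
  have h1 : A * (D * x - B * ξ) + B * (-C * x + A * ξ) = x := by linear_combination x * hS
  have h2 : C * (D * x - B * ξ) + D * (-C * x + A * ξ) = ξ := by linear_combination ξ * hS
  rw [h1, h2] at h
  rw [← h, T.inner_map_map]

/-- The matrix `(a b; b d)` is `(I + S⁻ᵀS⁻¹)/2`: one half comes from the averaging weight, the other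
from the ambiguity function of a Gaussian pulled back by `S⁻¹`. -/
theorem norm_smoothedKernel_sq {A B C D : ℝ} (hS : A * D - B * C = 1) {T : L2 ≃ₗᵢ[ℂ] L2}
    (hT : IsMetaplectic A B C D T) {k : 𝓢'(ℝ × ℝ, ℂ)} (hk : IsKernel T k) {a b d e : ℝ}
    (ha : a = (1 + C ^ 2 + D ^ 2) / 2) (hb : b = -(A * C + B * D) / 2)
    (hd : d = (1 + A ^ 2 + B ^ 2) / 2) (he : e = a - b ^ 2 / d) (he0 : 0 < e) (x y : ℝ) :
    ‖smoothedKernel k (x, y)‖ ^ 2 = 1 / 2 * (Real.sqrt (1 / d) * Real.sqrt (1 / e)) *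
      Real.exp (-(Real.pi * ((A * y - x) ^ 2 / d +
        (-(C * y) - (A * y - x) * b / d) ^ 2 / e))) := by
  have hd0 : 0 < d := by rw [hd]; positivity
  have hed : e * d = a * d - b ^ 2 := by rw [he]; field_simp
  -- Translating by `-x` moves the test Gaussian to the origin; passed through `T`, the shift
  -- becomes `S⁻¹(-x, 0) = (-Dx, Cx)`.
  set h : L2 := rho (-x) 0 0 (T (gaussianL2 y)) with hh
  have hTu : h = T (rho (-(D * x)) (C * x) 0 (gaussianL2 y)) := by
    have := hT (-(D * x)) (C * x) 0 (T (gaussianL2 y))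
    rw [T.symm_apply_apply] at this
    rw [this, hh]
    congr 1
    · linear_combination x * hS
    · ring
  have hK : ∫ t : ℝ, h t * gaussian₁ t = smoothedKernel k (x, y) := by
    rw [smoothedKernel_apply hk, ← integral_add_right_eq_self (fun t => (T (gaussianL2 y) : ℝ → ℂ) t * gaussianTranslate x t) x]
    refine integral_congr_ae ?_
    filter_upwards [rho_coeFn (-x) 0 0 (T (gaussianL2 y))] with t ht
    rw [hh, ht, gaussian₁_apply, gaussianTranslate_apply]
    simp [schrodingerFun]
  have key := integral_integral_gaussian_mul_ambiguity h
  rw [hK, hTu] at key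
  simp only [hT.inner_rho hS, ambiguity_rho_gaussianL2] at key
  have h2 := integral_integral_gaussian_quadratic hd0 he0 hed (-(C * y)) (A * y - x)
  have h3 : ∀ w z : ℝ, Complex.exp (-(Real.pi * (w ^ 2 + z ^ 2) / 2 : ℝ)) *
      ((Real.sqrt (1 / 2) : ℂ) * Complex.exp (-(Real.pi * ((D * w - B * z) ^ 2 +
          (-C * w + A * z) ^ 2) / 2 : ℝ) +
        (2 * Real.pi * ((-C * w + A * z) * (-(D * x) + y) - C * x * (D * w - B * z)) : ℝ) *
          Complex.I)) =
      (Real.sqrt (1 / 2) : ℂ) *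
        Complex.exp (-(Real.pi * (a * w ^ 2 + 2 * b * w * z + d * z ^ 2) : ℝ) +
        (2 * Real.pi * (-(C * y) * w + (A * y - x) * z) : ℝ) * Complex.I) := by
    intro w z
    rw [mul_left_comm, ← Complex.exp_add]
    congr 2
    have : (-C * w + A * z) * (-(D * x) + y) - C * x * (D * w - B * z) =
      -(C * y) * w + (A * y - x) * z := by linear_combination -(x * z) * hS
    rw [this, ha, hb, hd]
    push_cast
    ring
  simp only [h3, integral_const_mul, h2] at key
  norm_cast at key
  have h4 : Real.sqrt (1 / 2) * Real.sqrt 2 = 1 := by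
    rw [← Real.sqrt_mul (by norm_num)]; norm_num
  have h5 : Real.sqrt (1 / 2) * Real.sqrt (1 / 2) = 1 / 2 := Real.mul_self_sqrt (by norm_num)
  linear_combination -(Real.sqrt (1 / 2)) * key - ‖smoothedKernel k (x, y)‖ ^ 2 * h4 +
    (Real.sqrt (1 / d) * Real.sqrt (1 / e) *
      Real.exp (-(Real.pi * ((A * y - x) ^ 2 / d +
        (-(C * y) - (A * y - x) * b / d) ^ 2 / e)))) * h5

/-! ### Decay estimates and the dichotomy. -/

theorem japaneseBracket_pos (u : ℝ) : 0 < japaneseBracket u :=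
  Real.sqrt_pos.2 (by positivity)

theorem japaneseBracket_sq (u : ℝ) : japaneseBracket u ^ 2 = 1 + u ^ 2 := by
  rw [japaneseBracket, Real.sq_sqrt (by positivity), sq_abs]

theorem abs_le_japaneseBracket (u : ℝ) : |u| ≤ japaneseBracket u :=
  Real.le_sqrt_of_sq_le (by linarith)

theorem one_add_sq_pow_mul_exp_le {κ : ℝ} (hκ : 0 < κ) (N : ℕ) (u : ℝ) :
    (1 + u ^ 2) ^ N * Real.exp (-(κ * u ^ 2)) ≤ N.factorial * Real.exp κ / κ ^ N := by
  have h := Real.pow_div_factorial_le_exp (κ * (1 + u ^ 2)) (by positivity) N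
  rw [div_le_iff₀ (by positivity), mul_pow] at h
  rw [le_div_iff₀ (by positivity)]
  have h2 : Real.exp (κ * (1 + u ^ 2)) * Real.exp (-(κ * u ^ 2)) = Real.exp κ := by
    rw [← Real.exp_add]; ring_nf
  calc _ = (κ ^ N * (1 + u ^ 2) ^ N) * Real.exp (-(κ * u ^ 2)) := by ring
    _ ≤ (Real.exp (κ * (1 + u ^ 2)) * N.factorial) * Real.exp (-(κ * u ^ 2)) := by gcongr
    _ = _ := by rw [← h2]; ring

/-- A continuous function with Gaussian decay off the diagonal is a diagonal kernel. -/
theorem isDiagonalKernel_of_gaussian_bound {K : ℝ × ℝ → ℂ} (hK : Continuous K) {c κ : ℝ}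
    (hc : 0 < c) (hκ : 0 < κ)
    (h : ∀ x y, ‖K (x, y)‖ ^ 2 ≤ c * Real.exp (-(κ * (x - y) ^ 2))) : IsDiagonalKernel K := by
  refine ⟨hK, fun N _ => ⟨Real.sqrt (c * (N.factorial * Real.exp κ / κ ^ N)),
    Real.sqrt_pos.2 (by positivity), fun x y => ?_⟩⟩
  have hJ := japaneseBracket_pos (x - y)
  rw [zpow_neg, zpow_natCast, ← div_eq_mul_inv, le_div_iff₀ (by positivity)]
  refine Real.le_sqrt_of_sq_le ?_
  calc (‖K (x, y)‖ * japaneseBracket (x - y) ^ N) ^ 2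
      = ‖K (x, y)‖ ^ 2 * (1 + (x - y) ^ 2) ^ N := by
        rw [← japaneseBracket_sq]; ring
    _ ≤ (c * Real.exp (-(κ * (x - y) ^ 2))) * (1 + (x - y) ^ 2) ^ N := by
        gcongr; exact h x y
    _ = c * ((1 + (x - y) ^ 2) ^ N * Real.exp (-(κ * (x - y) ^ 2))) := by ring
    _ ≤ _ := by gcongr; exact one_add_sq_pow_mul_exp_le hκ N _

/-- The right side is the inverse form of `(a b; b d)`, whose eigenvalues are at most the trace `a +
d`. After clearing denominators the difference is exactly `(as - br)² + (bs - dr)²`. -/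
theorem sq_add_sq_div_le {a b d e : ℝ} (ha : 0 < a) (hd : 0 < d) (he : 0 < e)
    (h : e * d = a * d - b ^ 2) (r s : ℝ) :
    (r ^ 2 + s ^ 2) / (a + d) ≤ s ^ 2 / d + (r - s * b / d) ^ 2 / e := by
  have h1 : s ^ 2 / d + (r - s * b / d) ^ 2 / e =
      (a * s ^ 2 - 2 * b * r * s + d * r ^ 2) / (e * d) := by
    field_simp
    linear_combination s ^ 2 * h
  rw [h1, div_le_div_iff₀ (by positivity) (by positivity), h]
  nlinarith [sq_nonneg (a * s - b * r), sq_nonneg (b * s - d * r)]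

theorem exists_sq_sub_le {A B C D : ℝ} (hS : A * D - B * C = 1) (h : D = 1 ∨ C ≠ 0) :
    ∃ M : ℝ, 0 < M ∧ ∀ x y : ℝ, (x - y) ^ 2 ≤ M * ((-(C * y)) ^ 2 + (A * y - x) ^ 2) := by
  by_cases hC : C = 0
  · have hD : D = 1 := h.resolve_right (not_not.2 hC)
    have hA : A = 1 := by simpa [hC, hD] using hS
    exact ⟨1, one_pos, fun x y => le_of_eq (by rw [hA, hC]; ring)⟩
  -- Write `x - y = (A - 1)y - (Ay - x)` and bound `y` through `Cy`.
  · refine ⟨2 * (1 + (A - 1) ^ 2 / C ^ 2), by positivity, fun x y => ?_⟩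
    have h1 : ((A - 1) * y) ^ 2 = (A - 1) ^ 2 / C ^ 2 * (-(C * y)) ^ 2 := by field_simp
    have h2 : 0 ≤ (A - 1) ^ 2 / C ^ 2 * (A * y - x) ^ 2 := by positivity
    nlinarith [sq_nonneg ((A - 1) * y + (A * y - x)), sq_nonneg (C * y)]

theorem isQuasiDiagonal_iff {A B C D : ℝ} (hS : A * D - B * C = 1) {T : L2 ≃ₗᵢ[ℂ] L2}
    (hT : IsMetaplectic A B C D T) {k : 𝓢'(ℝ × ℝ, ℂ)} (hk : IsKernel T k) :
    IsQuasiDiagonal k ↔ (D = 1 ∨ C ≠ 0) := by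
  obtain ⟨a, ha⟩ : ∃ a, a = (1 + C ^ 2 + D ^ 2) / 2 := ⟨_, rfl⟩
  obtain ⟨b, hb⟩ : ∃ b, b = -(A * C + B * D) / 2 := ⟨_, rfl⟩
  obtain ⟨d, hd⟩ : ∃ d, d = (1 + A ^ 2 + B ^ 2) / 2 := ⟨_, rfl⟩
  obtain ⟨e, he⟩ : ∃ e, e = a - b ^ 2 / d := ⟨_, rfl⟩
  have ha0 : 0 < a := by rw [ha]; positivity
  have hd0 : 0 < d := by rw [hd]; positivity
  have hed : e * d = a * d - b ^ 2 := by rw [he]; field_simp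
  have he0 : 0 < e := by
    refine pos_of_mul_pos_left (b := d) ?_ hd0.le
    -- Lagrange's identity: `(A² + B²)(C² + D²) - (AC + BD)² = (AD - BC)² = 1`.
    have : a * d - b ^ 2 = (2 + A ^ 2 + B ^ 2 + C ^ 2 + D ^ 2) / 4 := by
      rw [ha, hb, hd]
      linear_combination (A * D - B * C + 1) / 4 * hS
    rw [hed, this]
    positivity
  have hK := norm_smoothedKernel_sq hS hT hk ha hb hd he he0
  obtain ⟨c, hc⟩ : ∃ c, c = 1 / 2 * (Real.sqrt (1 / d) * Real.sqrt (1 / e)) := ⟨_, rfl⟩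
  have hc0 : 0 < c := by rw [hc]; positivity
  simp only [← hc] at hK
  constructor
  · intro hq
    by_contra! hcon
    obtain ⟨hD, hC⟩ := hcon
    have hA : A - 1 ≠ 0 := by
      intro hA
      apply hD
      have : A = 1 := by linarith
      simpa [hC, this] using hS
    obtain ⟨M, hM, hbound⟩ := hq.2 1 one_pos
    -- Decay of order `N = 1` already fails: at `(Ay, y)` the modulus is `√c`, and this offset from
    -- the diagonal would force `M + √c ≤ M`.
    obtain ⟨y, hy⟩ : ∃ y, (A - 1) * y = M / Real.sqrt c + 1 :=
      ⟨(M / Real.sqrt c + 1) / (A - 1), by field_simp⟩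
    have h1 := hbound (A * y) y
    have h2 : ‖smoothedKernel k (A * y, y)‖ = Real.sqrt c := by
      rw [← Real.sqrt_sq (norm_nonneg _), hK, hC]
      simp
    rw [h2, Nat.cast_one, zpow_neg, zpow_one, ← div_eq_mul_inv,
      le_div_iff₀ (japaneseBracket_pos _)] at h1
    have h3 : M / Real.sqrt c + 1 ≤ japaneseBracket (A * y - y) := by
      rw [← hy, show (A - 1) * y = A * y - y by ring]
      exact (le_abs_self _).trans (abs_le_japaneseBracket _)
    have hs : 0 < Real.sqrt c := Real.sqrt_pos.2 hc0
    have h4 := (mul_le_mul_of_nonneg_left h3 hs.le).trans h1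
    rw [mul_add, mul_div_cancel₀ _ hs.ne'] at h4
    linarith
  · intro h
    obtain ⟨M, hM, hxy⟩ := exists_sq_sub_le hS h
    refine isDiagonalKernel_of_gaussian_bound (continuous_smoothedKernel hk) hc0
      (κ := Real.pi / (M * (a + d))) (by positivity) fun x y => ?_
    rw [hK]
    refine mul_le_mul_of_nonneg_left (Real.exp_le_exp.2 (neg_le_neg ?_)) hc0.le
    calc Real.pi / (M * (a + d)) * (x - y) ^ 2
        = Real.pi * ((x - y) ^ 2 / M / (a + d)) := by field_simp
      _ ≤ Real.pi * (((-(C * y)) ^ 2 + (A * y - x) ^ 2) / (a + d)) := by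
        gcongr
        rw [div_le_iff₀ hM, mul_comm]
        exact hxy x y
      _ ≤ _ :=
        mul_le_mul_of_nonneg_left (sq_add_sq_div_le ha0 hd0 he0 hed _ _) Real.pi_pos.le

end Metaplectic

theorem proposition1p4 (A B C D : ℝ) (hS : A * D - B * C = 1)
    (T : Metaplectic.L2 ≃ₗᵢ[ℂ] Metaplectic.L2) (hT : Metaplectic.IsMetaplectic A B C D T)
    (k : TemperedDistribution (ℝ × ℝ) ℂ) (hk : Metaplectic.IsKernel T k) :
    Metaplectic.IsQuasiDiagonal k ↔ (D = 1 ∨ C ≠ 0) :=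
  Metaplectic.isQuasiDiagonal_iff hS hT hk
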